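/- Let $R$ be a discrete valuation ring with maximal ideal $\mathfrak m$, fraction field $K$ and residue field $k$, let $L/K$ be a finite separable field extension, and let $S$ be the integral closure of $R$ in $L$. Call $L/K$ unramified if every maximal ideal $\mathfrak q$ of $S$ has ramification index $e(\mathfrak q\mid\mathfrak m)=1$ and separable residue field extension $(S/\mathfrak q)/k$, and ramified if $e(\mathfrak q\mid\mathfrak m)>1$ for some maximal ideal $\mathfrak q$ of $S$. Let $X$ be a regular scheme that is locally of finite type over $R$, and put $X_S := X\times_{\operatorname{Spec} R}\operatorname{Spec} S$ and $X_k := X\times_{\operatorname{Spec} R}\operatorname{Spec} k$. (1) If $L/K$ is unramified, then $X_S$ is regular. (2) Suppose that $L/K$ is ramified, that for every maximal ideal $\mathfrak q$ of $S$ the residue field extension $(S/\mathfrak q)/k$ is separable (which is automatic when $k$ is perfect), and that $X$ is flat over $R$. Then $X_S$ is regular if and only if $X_k$ is regular. -/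

import Mathlib

open CategoryTheory CategoryTheory.Limits AlgebraicGeometry IsLocalRing

universe u

namespace BaseChangeRegularity

/-- A scheme is regular if all its local rings are regular (Noetherian) local rings. All schemes
to which this is applied are locally of finite type over a Noetherian ring, hence locally
Noetherian. -/
def IsRegularScheme (X : Scheme.{u}) : Prop :=
  ∀ x : X, IsRegularLocalRing (X.presheaf.stalk x)

/-- For a local ring `R` with residue field `k` and an `R`-algebra `S`: for every prime `q` of `S`
over the maximal ideal of `R`, the residue field extension `S ⧸ q` of `k` is separable. -/
def HasSeparableResidueExtensions (R S : Type*) [CommRing R] [IsLocalRing R] [CommRing S]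
    [Algebra R S] : Prop :=
  ∀ (q : Ideal S) [q.IsPrime] [q.LiesOver (maximalIdeal R)],
    Algebra.IsSeparable (R ⧸ maximalIdeal R) (S ⧸ q)

/-- Unramified: every prime `q` of `S` over the maximal ideal of `R` has ramification index `1`,
and its residue field extension is separable. -/
def IsUnramified (R S : Type*) [CommRing R] [IsLocalRing R] [CommRing S] [Algebra R S] : Prop :=
  (∀ (q : Ideal S) [q.IsPrime] [q.LiesOver (maximalIdeal R)], q.ramificationIdx R = 1) ∧
    HasSeparableResidueExtensions R S

/-- Ramified: some prime `q` of `S` over the maximal ideal of `R` has ramification index `> 1`. -/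
def IsRamified (R S : Type*) [CommRing R] [IsLocalRing R] [CommRing S] [Algebra R S] : Prop :=
  ∃ (q : Ideal S) (_ : q.IsPrime) (_ : q.LiesOver (maximalIdeal R)), 1 < q.ramificationIdx R

/-- The base change `X ×_R T` of `f : X ⟶ Spec R` along the structure map of an `R`-algebra `T`. -/
noncomputable abbrev baseChange {R : Type u} [CommRing R] {X : Scheme.{u}}
    (f : X ⟶ Spec (CommRingCat.of R)) (T : Type u) [CommRing T] [Algebra R T] : Scheme.{u} :=
  pullback f (Spec.map (CommRingCat.ofHom (algebraMap R T)))

end BaseChangeRegularity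

/-! Regularity is local on `X`, so take `X = Spec A` with `A` regular Noetherian and put `C = A ⊗[R]
S`, which is finite over `A`. Let `P` be a prime of `C` over a prime `q` of `S`.

If `R → S` is unramified at `q`, then `A → C` is flat and unramified at `P`. A flat local map whose
closed fibre is a field preserves dimension and embedding dimension
(`isRegularLocalRing_iff_of_flat`), so `C_P` is regular. This settles (1), and also the primes over
`q = ⊥`, where unramifiedness is the separability of `L/K`.

For `q` over `m`, `C ⧸ qC` is the base change of `A ⧸ mA` along the separable extension `S ⧸ q` of
`R ⧸ m`, so the two fibres are regular together (`isRegularLocalRing_iff_quotientMapAlgebra`). It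
remains to compare `C_P` with `C_P ⧸ (t)`, where `t` generates `q` locally. If `A` is flat, `t` is a
nonzerodivisor on `C_P`, and regularity lifts from the quotient. Conversely, if `C_P` is regular, `t
∉ m_P ^ 2` is needed. Otherwise Nakayama gives `m_P = p C_P` with `p = P ∩ A`, so `t ∈ p C_P`;
flatness then forces `t ∈ m S_q` (`Algebra.IsPushout.mem_map_of_mem_map`), that is `e(q | m) = 1`,
against ramification. -/

section LocalRings

/-! ### Regular local rings: flat local maps and quotients by one element. -/

variable (R : Type*) [CommRing R] [IsLocalRing R] [IsNoetherianRing R]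

lemma IsLocalRing.length_cotangentSpace :
    Module.length R (CotangentSpace R) = (maximalIdeal R).spanFinrank := by
  rw [spanFinrank_maximalIdeal_eq_finrank_cotangentSpace, ← Module.length_eq_finrank]
  exact Module.length_eq_of_surjective Ideal.Quotient.mk_surjective

/-- Comes from `0 → m/m² → R/m² → R/m → 0`. It expresses the embedding dimension as a length, which
is easy to follow along flat base change and surjections. -/
lemma IsLocalRing.length_quotient_maximalIdeal_sq :
    Module.length R (R ⧸ maximalIdeal R ^ 2) = (maximalIdeal R).spanFinrank + 1 := by
  have hle : maximalIdeal R ^ 2 ≤ maximalIdeal R := Ideal.pow_le_self two_ne_zero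
  let g : (R ⧸ maximalIdeal R ^ 2) →ₗ[R] (R ⧸ maximalIdeal R) :=
    (Ideal.Quotient.factorₐ R hle).toLinearMap
  have hg : Function.Surjective g := Ideal.Quotient.factor_surjective hle
  rw [Module.length_eq_add_of_exact (maximalIdeal R).cotangentToQuotientSquare g
    (maximalIdeal R).cotangentToQuotientSquare_injective hg]
  · congr 1
    · exact length_cotangentSpace R
    · rw [Module.length_eq_one_iff, isSimpleModule_iff_isCoatom, ← Ideal.isMaximal_def]
      infer_instance
  · rw [LinearMap.exact_iff]
    ext x
    obtain ⟨x, rfl⟩ := Ideal.Quotient.mk_surjective x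
    constructor
    · intro hx
      have hx' : x ∈ maximalIdeal R := Ideal.Quotient.eq_zero_iff_mem.mp hx
      exact ⟨(maximalIdeal R).toCotangent ⟨x, hx'⟩, by simp⟩
    · rintro ⟨y, hy⟩
      obtain ⟨y, rfl⟩ := Ideal.toCotangent_surjective _ y
      rw [← hy, LinearMap.mem_ker, Ideal.toCotangent_to_quotient_square]
      exact Ideal.Quotient.eq_zero_iff_mem.mpr y.2

variable {R}

/-- The embedding dimension does not change along a flat local homomorphism whose closed fibre is
a field. -/
lemma IsLocalRing.spanFinrank_maximalIdeal_eq_of_flat {S : Type*} [CommRing S] [IsLocalRing S]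
    [IsNoetherianRing S] [Algebra R S] [Module.Flat R S]
    (h : (maximalIdeal R).map (algebraMap R S) = maximalIdeal S) :
    (maximalIdeal S).spanFinrank = (maximalIdeal R).spanFinrank := by
  have : IsLocalHom (algebraMap R S) :=
    ((local_hom_TFAE (algebraMap R S)).out 0 2 rfl rfl).mpr h.le
  -- Under flat base change, length is multiplied by the length of the closed fibre, which is one
  -- here.
  have e := length_baseChange R S (R ⧸ maximalIdeal R ^ 2)
  have e1 : Module.length S (S ⧸ maximalIdeal S) = 1 := by
    rw [Module.length_eq_one_iff, isSimpleModule_iff_isCoatom, ← Ideal.isMaximal_def]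
    infer_instance
  have e2 := (Algebra.TensorProduct.quotIdealMapEquivTensorQuot (A := R) S
    (maximalIdeal R ^ 2)).toLinearEquiv.length_eq
  rw [h, e1, mul_one, length_quotient_maximalIdeal_sq, ← e2, Ideal.map_pow, h,
    length_quotient_maximalIdeal_sq] at e
  exact Nat.succ_injective (by exact_mod_cast e)

/-- The dimension does not change along a flat local homomorphism whose closed fibre is a field. -/
lemma IsLocalRing.ringKrullDim_eq_of_flat {S : Type*} [CommRing S] [IsLocalRing S]
    [IsNoetherianRing S] [Algebra R S] [Module.Flat R S]
    (h : (maximalIdeal R).map (algebraMap R S) = maximalIdeal S) :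
    ringKrullDim S = ringKrullDim R := by
  have hl : IsLocalHom (algebraMap R S) :=
    ((local_hom_TFAE (algebraMap R S)).out 0 2 rfl rfl).mpr h.le
  have : (maximalIdeal S).LiesOver (maximalIdeal R) :=
    ⟨(((local_hom_TFAE (algebraMap R S)).out 0 4 rfl rfl).mp hl).symm⟩
  -- Flatness gives going down, so the heights differ by the dimension of the closed fibre, a field.
  have e := Ideal.height_eq_height_add_of_liesOver_of_hasGoingDown (maximalIdeal R) (maximalIdeal S)
  rw [h, Ideal.map_quotient_self] at e
  have : Nontrivial (S ⧸ maximalIdeal S) := inferInstance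
  have hb : (⊥ : Ideal (S ⧸ maximalIdeal S)).height = 0 := by
    let := Ideal.Quotient.field (maximalIdeal S)
    exact Ideal.height_bot
  rw [hb, add_zero] at e
  rw [← maximalIdeal_height_eq_ringKrullDim, ← maximalIdeal_height_eq_ringKrullDim, e]

lemma isRegularLocalRing_iff_of_flat {S : Type*} [CommRing S] [IsLocalRing S]
    [IsNoetherianRing S] [Algebra R S] [Module.Flat R S]
    (h : (maximalIdeal R).map (algebraMap R S) = maximalIdeal S) :
    IsRegularLocalRing R ↔ IsRegularLocalRing S := by
  rw [isRegularLocalRing_iff, isRegularLocalRing_iff, spanFinrank_maximalIdeal_eq_of_flat h,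
    ringKrullDim_eq_of_flat h]

variable {t : R}

omit [IsNoetherianRing R] in
lemma IsLocalRing.map_mk_maximalIdeal {I : Ideal R} [IsLocalRing (R ⧸ I)] :
    (maximalIdeal R).map (Ideal.Quotient.mk I) = maximalIdeal (R ⧸ I) :=
  (Ideal.map_eq_top_or_isMaximal_of_surjective _ Ideal.Quotient.mk_surjective
    (maximalIdeal.isMaximal R)).elim
    (fun h ↦ by
      have hI : I ≤ maximalIdeal R := le_maximalIdeal fun hI ↦
        not_subsingleton (R ⧸ I) (Ideal.Quotient.subsingleton_iff.mpr hI)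
      have := Ideal.comap_map_of_surjective _ (Ideal.Quotient.mk_surjective (I := I))
        (maximalIdeal R)
      rw [h, Ideal.comap_top, ← RingHom.ker_eq_comap_bot, Ideal.mk_ker, sup_of_le_left hI] at this
      exact ((maximalIdeal.isMaximal R).ne_top this.symm).elim)
    fun h ↦ eq_maximalIdeal h

/-- A local ring is regular if its quotient by a nonzerodivisor in the maximal ideal is. -/
lemma IsRegularLocalRing.of_quotient_span_singleton (ht : t ∈ maximalIdeal R)
    (hr : t ∈ nonZeroDivisors R) [IsRegularLocalRing (R ⧸ Ideal.span {t})] :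
    IsRegularLocalRing R := by
  apply of_spanFinrank_maximalIdeal_le
  rw [← ringKrullDim_quotient_span_singleton_succ_eq_ringKrullDim_of_mem_nonZeroDivisors hr ht,
    ← (isRegularLocalRing_iff _).mp ‹IsRegularLocalRing (R ⧸ Ideal.span {t})›]
  obtain ⟨s, hs, hs'⟩ := Submodule.FG.exists_span_finset_card_eq_spanFinrank
    (maximalIdeal (R ⧸ Ideal.span {t})).fg_of_isNoetherianRing
  classical
  -- Lifts of a minimal generating set of the maximal ideal of the quotient, together with `t`,
  -- generate the maximal ideal of `R`; the dimension also rises by exactly one.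
  let s' : Finset R := insert t (s.image Quotient.out)
  have hspan : Ideal.span (s' : Set R) = maximalIdeal R := by
    have h1 : (Ideal.span (Quotient.out '' (s : Set (R ⧸ Ideal.span {t})))).map
        (Ideal.Quotient.mk (Ideal.span {t})) =
        (maximalIdeal R).map (Ideal.Quotient.mk (Ideal.span {t})) := by
      rw [map_mk_maximalIdeal, Ideal.map_span, Set.image_image]
      simpa using! hs'
    have h2 := congrArg (Ideal.comap (Ideal.Quotient.mk (Ideal.span {t}))) h1
    rw [Ideal.comap_map_of_surjective _ Ideal.Quotient.mk_surjective,
      Ideal.comap_map_of_surjective _ Ideal.Quotient.mk_surjective, ← RingHom.ker_eq_comap_bot,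
      Ideal.mk_ker, sup_of_le_left ((Ideal.span_singleton_le_iff_mem _).mpr ht)] at h2
    rw [← h2, sup_comm, ← Ideal.span_union]
    simp [s']
  have hle : (maximalIdeal R).spanFinrank ≤ s.card + 1 := by
    rw [← hspan]
    refine (Submodule.spanFinrank_span_le_ncard_of_finite s'.finite_toSet).trans ?_
    rw [Set.ncard_coe_finset]
    exact (Finset.card_insert_le _ _).trans (Nat.succ_le_succ Finset.card_image_le)
  rw [← hs]
  exact_mod_cast hle

/-- The quotient of a regular local ring by an element of a regular system of parameters is
regular. -/
lemma IsRegularLocalRing.quotient_span_singleton {R : Type*} [CommRing R]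
    [IsRegularLocalRing R] {t : R} (ht : t ∈ maximalIdeal R)
    (ht' : t ∉ maximalIdeal R ^ 2) : IsRegularLocalRing (R ⧸ Ideal.span {t}) := by
  have htt : Ideal.span {t} ≤ maximalIdeal R := (Ideal.span_singleton_le_iff_mem _).mpr ht
  have : Nontrivial (R ⧸ Ideal.span {t}) := Ideal.Quotient.nontrivial_iff.mpr
    (ne_top_of_le_ne_top (maximalIdeal.isMaximal R).ne_top htt)
  have : IsLocalRing (R ⧸ Ideal.span {t}) := .of_surjective' _ Ideal.Quotient.mk_surjective
  apply of_spanFinrank_maximalIdeal_le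
  have hdim : ringKrullDim R ≤ ringKrullDim (R ⧸ Ideal.span {t}) + 1 := by
    have := ringKrullDim_le_ringKrullDim_quotient_add_card {t} (R := R)
      (by simpa [ringJacobson_eq_maximalIdeal] using ht)
    rwa [Finset.coe_singleton, Finset.card_singleton, Nat.cast_one] at this
  rw [← (isRegularLocalRing_iff R).mp inferInstance] at hdim
  -- The dimension drops by at most one. The class of `t` is a nonzero element of `R/m²` that dies
  -- in the quotient, so the embedding dimension drops by at least one.
  have hl : Module.length R ((R ⧸ Ideal.span {t}) ⧸ maximalIdeal (R ⧸ Ideal.span {t}) ^ 2) <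
      Module.length R (R ⧸ maximalIdeal R ^ 2) := by
    have hle : maximalIdeal R ^ 2 ≤ (maximalIdeal (R ⧸ Ideal.span {t}) ^ 2).comap
        (Ideal.Quotient.mkₐ R (Ideal.span {t})) := by
      rw [← map_mk_maximalIdeal, ← Ideal.map_pow]
      exact Ideal.le_comap_map
    let f : (R ⧸ maximalIdeal R ^ 2) →ₗ[R]
        ((R ⧸ Ideal.span {t}) ⧸ maximalIdeal (R ⧸ Ideal.span {t}) ^ 2) :=
      (Ideal.quotientMapₐ (maximalIdeal (R ⧸ Ideal.span {t}) ^ 2)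
        (Ideal.Quotient.mkₐ R (Ideal.span {t})) hle).toLinearMap
    have hf : Function.Surjective f := Ideal.quotientMap_surjective (H := hle) Ideal.Quotient.mk_surjective
    have hk : LinearMap.ker f ≠ ⊥ := by
      intro hk
      have : Ideal.Quotient.mk (maximalIdeal R ^ 2) t ∈ LinearMap.ker f := by
        rw [LinearMap.mem_ker]
        change Ideal.Quotient.mk (maximalIdeal (R ⧸ Ideal.span {t}) ^ 2)
          (Ideal.Quotient.mk (Ideal.span {t}) t) = 0
        rw [Ideal.Quotient.eq_zero_iff_mem.mpr (Ideal.mem_span_singleton_self t), map_zero]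
      rw [hk, Submodule.mem_bot] at this
      exact ht' (Ideal.Quotient.eq_zero_iff_mem.mp this)
    -- Finite length is what makes the length of a proper quotient strictly smaller.
    have hfin : Module.length R (R ⧸ maximalIdeal R ^ 2) ≠ ⊤ := by
      rw [length_quotient_maximalIdeal_sq]
      exact ENat.natCast_ne_top ((maximalIdeal R).spanFinrank + 1)
    have hfl := Module.length_ne_top_iff.mp hfin
    rw [isFiniteLength_iff_isNoetherian_isArtinian] at hfl
    obtain ⟨_, _⟩ := hfl
    rw [← (f.quotKerEquivOfSurjective hf).length_eq]
    exact Submodule.length_quotient_lt _ hk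
  rw [Module.length_eq_of_surjective (R := R ⧸ Ideal.span {t}) Ideal.Quotient.mk_surjective,
    length_quotient_maximalIdeal_sq, length_quotient_maximalIdeal_sq] at hl
  have hl' : (maximalIdeal (R ⧸ Ideal.span {t})).spanFinrank + 1 ≤
      (maximalIdeal R).spanFinrank := by
    have : (maximalIdeal (R ⧸ Ideal.span {t})).spanFinrank + 1 <
      (maximalIdeal R).spanFinrank + 1 := by exact_mod_cast hl
    omega
  have h3 : (((maximalIdeal (R ⧸ Ideal.span {t})).spanFinrank : ℕ) : WithBot ℕ∞) + 1 ≤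
      ringKrullDim (R ⧸ Ideal.span {t}) + 1 := le_trans (by exact_mod_cast hl') hdim
  exact ENat.WithBot.add_le_add_one_right_iff.mp h3

end LocalRings

/-! ### Unramified primes, base change and fibres. -/

section Unramified

open TensorProduct

/-- Regularity ascends and descends along flat algebras at unramified primes. -/
lemma Algebra.IsUnramifiedAt.isRegularLocalRing_iff {A C : Type*} [CommRing A] [CommRing C]
    [Algebra A C] [Module.Flat A C] [IsNoetherianRing A] [IsNoetherianRing C]
    [Algebra.EssFiniteType A C] (p : Ideal A) [p.IsPrime] (P : Ideal C) [P.IsPrime] [P.LiesOver p]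
    [Algebra.IsUnramifiedAt A P] :
    IsRegularLocalRing (Localization.AtPrime p) ↔ IsRegularLocalRing (Localization.AtPrime P) := by
  let := Localization.AtPrime.algebraOfLiesOver p P
  have : Algebra.EssFiniteType (Localization.AtPrime p) (Localization.AtPrime P) := .of_comp A _ _
  -- An unramified local map carries the maximal ideal onto a generating set of the maximal ideal,
  -- so the closed fibre is a field.
  exact isRegularLocalRing_iff_of_flat Algebra.FormallyUnramified.map_maximalIdeal

section Pushout

variable (R S A C : Type*) [CommRing R] [CommRing S] [CommRing A] [CommRing C] [Algebra R S]
  [Algebra R A] [Algebra R C] [Algebra S C] [Algebra A C] [IsScalarTower R S C]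
  [IsScalarTower R A C] [Algebra.IsPushout R S A C]

include R S in
lemma Algebra.IsPushout.flat [Module.Flat R S] : Module.Flat A C :=
  have : Algebra.IsPushout R A S C := .symm ‹_›
  .of_linearEquiv (Algebra.IsPushout.equiv R A S C).symm.toLinearEquiv

include R S in
lemma Algebra.IsPushout.faithfullyFlat [Module.FaithfullyFlat R S] : Module.FaithfullyFlat A C :=
  have : Algebra.IsPushout R A S C := .symm ‹_›
  .of_linearEquiv _ _ (Algebra.IsPushout.equiv R A S C).symm.toLinearEquiv

include R S in
lemma Algebra.IsPushout.finite [Module.Finite R S] : Module.Finite A C :=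
  have : Algebra.IsPushout R A S C := .symm ‹_›
  .equiv (Algebra.IsPushout.equiv R A S C).toLinearEquiv

include R S in
lemma Algebra.IsPushout.formallyUnramified [Algebra.FormallyUnramified R S] :
    Algebra.FormallyUnramified A C :=
  have : Algebra.IsPushout R A S C := .symm ‹_›
  .of_equiv (Algebra.IsPushout.equiv R A S C)

include R A in
-- `A ⊗[R] S_q` is unramified over `A` by base change, and `C → C_P` factors through it. Since `C_P`
-- is formally unramified over `C`, it is so over the intermediate ring.
lemma Algebra.IsPushout.isUnramifiedAt (q : Ideal S) [q.IsPrime] (P : Ideal C) [P.IsPrime]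
    [P.LiesOver q] [Algebra.IsUnramifiedAt R q] : Algebra.IsUnramifiedAt A P := by
  let := Localization.AtPrime.algebraOfLiesOver q P
  have : Algebra.IsPushout R A S C := .symm ‹_›
  let Sq := Localization.AtPrime q
  let CP := Localization.AtPrime P
  let f : A ⊗[R] Sq →ₐ[A] CP :=
    Algebra.TensorProduct.lift (Algebra.ofId A CP) (IsScalarTower.toAlgHom R Sq CP)
      (fun _ _ ↦ .all _ _)
  let g : C →ₐ[A] A ⊗[R] Sq := (Algebra.TensorProduct.map (AlgHom.id A A)
    (IsScalarTower.toAlgHom R S Sq)).comp (Algebra.IsPushout.equiv R A S C).symm.toAlgHom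
  let : Algebra (A ⊗[R] Sq) CP := f.toAlgebra
  let : Algebra C (A ⊗[R] Sq) := g.toAlgebra
  have : IsScalarTower A (A ⊗[R] Sq) CP := .of_algHom f
  have hfg : f.comp g = IsScalarTower.toAlgHom A C CP := by
    have : (f.comp g).comp (Algebra.IsPushout.equiv R A S C).toAlgHom =
        (IsScalarTower.toAlgHom A C CP).comp (Algebra.IsPushout.equiv R A S C).toAlgHom := by
      ext s
      have : (Algebra.IsPushout.equiv R A S C).symm (algebraMap S C s) = 1 ⊗ₜ s :=
        Algebra.IsPushout.equiv_symm_algebraMap_right R A S C s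
      simp [f, g, Algebra.IsPushout.equiv_tmul, ← IsScalarTower.algebraMap_apply, this]
    ext c
    simpa using DFunLike.congr_fun this ((Algebra.IsPushout.equiv R A S C).symm c)
  have : IsScalarTower C (A ⊗[R] Sq) CP :=
    .of_algebraMap_eq fun c ↦ (DFunLike.congr_fun hfg c).symm
  have : Algebra.FormallyUnramified C CP := .of_isLocalization P.primeCompl
  have : Algebra.FormallyUnramified (A ⊗[R] Sq) CP := .of_restrictScalars C _ _
  exact Algebra.FormallyUnramified.comp A (A ⊗[R] Sq) CP

end Pushout

lemma Algebra.IsPushout.quotient (A B : Type*) [CommRing A] [CommRing B] [Algebra A B]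
    (I : Ideal A) : Algebra.IsPushout A (A ⧸ I) B (B ⧸ I.map (algebraMap A B)) where
  out := .of_equiv (Algebra.TensorProduct.quotIdealMapEquivQuotTensor B I).symm.toLinearEquiv
    fun b ↦ (AlgEquiv.symm_apply_eq (Algebra.TensorProduct.quotIdealMapEquivQuotTensor B I)).mpr
      (Algebra.TensorProduct.quotIdealMapEquivQuotTensor_mk B I b).symm

/-- The back face of a cube is a pushout if the front, top and bottom faces are. -/
lemma Algebra.IsPushout.of_cube (R S A C k S' A' E : Type*) [CommRing R] [CommRing S] [CommRing A]
    [CommRing C] [CommRing k] [CommRing S'] [CommRing A'] [CommRing E]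
    [Algebra R S] [Algebra R A] [Algebra R C] [Algebra S C] [Algebra A C] [IsScalarTower R S C]
    [IsScalarTower R A C] [Algebra.IsPushout R S A C]
    [Algebra R k] [Algebra R A'] [Algebra A A'] [Algebra k A'] [IsScalarTower R A A']
    [IsScalarTower R k A'] [Algebra.IsPushout R k A A']
    [Algebra S S'] [Algebra S E] [Algebra C E] [Algebra S' E] [IsScalarTower S C E]
    [IsScalarTower S S' E] [Algebra.IsPushout S S' C E]
    [Algebra R S'] [Algebra R E] [Algebra A E] [Algebra k S'] [Algebra k E] [Algebra A' E]
    [IsScalarTower R S S'] [IsScalarTower R S E] [IsScalarTower R C E] [IsScalarTower A C E]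
    [IsScalarTower R A E] [IsScalarTower R S' E] [IsScalarTower R k S'] [IsScalarTower k S' E]
    [IsScalarTower k A' E] [IsScalarTower A A' E] [IsScalarTower R k E] [IsScalarTower R A' E] :
    Algebra.IsPushout k S' A' E := by
  have : Algebra.IsPushout R S' A E := (Algebra.IsPushout.comp_iff R S A (S' := C)).mpr inferInstance
  exact (Algebra.IsPushout.comp_iff R k A (S' := A')).mp inferInstance

section Fiber

variable {R S A C : Type*} [CommRing R] [CommRing S] [CommRing A] [CommRing C] [Algebra R S]
  [Algebra R A] [Algebra R C] [Algebra S C] [Algebra A C] [IsScalarTower R S C]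
  [IsScalarTower R A C] (m : Ideal R) (q : Ideal S) [q.LiesOver m]

/-- For `q ⊆ S` over `m ⊆ R` and a commutative square of rings `R → S → C`, `R → A → C`, the
`A ⧸ mA`-algebra structure on `C ⧸ qC`. -/
noncomputable abbrev quotientMapAlgebra :
    Algebra (A ⧸ m.map (algebraMap R A)) (C ⧸ q.map (algebraMap S C)) :=
  (Ideal.quotientMap (q.map (algebraMap S C)) (algebraMap A C) (by
    rw [Ideal.map_le_iff_le_comap, Ideal.comap_comap, ← IsScalarTower.algebraMap_eq,
      IsScalarTower.algebraMap_eq R S C, ← Ideal.comap_comap, ← Ideal.map_le_iff_le_comap]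
    exact (Ideal.map_le_of_le_comap (Ideal.over_def q m).le).trans Ideal.le_comap_map)).toAlgebra

lemma faithfullyFlat_quotient [m.IsMaximal] [q.IsPrime] :
    Module.FaithfullyFlat (R ⧸ m) (S ⧸ q) :=
  have : Module.Free (R ⧸ m) (S ⧸ q) :=
    let := Ideal.Quotient.field m
    Module.Free.of_divisionRing _ _
  have : Nontrivial (S ⧸ q) := inferInstance
  .of_linearEquiv _ _ (Module.Free.chooseBasis (R ⧸ m) (S ⧸ q)).repr

/-- The fibre map is the base change of the nonzero vector space `S ⧸ q` over the field `R ⧸ m`. The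
roles of `S` and `A` may be exchanged. -/
lemma faithfullyFlat_quotientMapAlgebra [Algebra.IsPushout R S A C] [m.IsMaximal] [q.IsPrime] :
    let := quotientMapAlgebra (A := A) (C := C) m q
    Module.FaithfullyFlat (A ⧸ m.map (algebraMap R A)) (C ⧸ q.map (algebraMap S C)) := by
  intro i
  let i' : Algebra (R ⧸ m) (C ⧸ q.map (algebraMap S C)) :=
    ((algebraMap (S ⧸ q) (C ⧸ q.map (algebraMap S C))).comp (algebraMap (R ⧸ m) (S ⧸ q))).toAlgebra
  have := Algebra.IsPushout.quotient R A m
  have := Algebra.IsPushout.quotient S C q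
  have : IsScalarTower (R ⧸ m) (S ⧸ q) (C ⧸ q.map (algebraMap S C)) :=
    .of_algebraMap_eq fun _ ↦ rfl
  have : IsScalarTower A (A ⧸ m.map (algebraMap R A)) (C ⧸ q.map (algebraMap S C)) :=
    .of_algebraMap_eq fun _ ↦ rfl
  have : IsScalarTower R (S ⧸ q) (C ⧸ q.map (algebraMap S C)) :=
    .of_algebraMap_eq fun r ↦ by
      rw [IsScalarTower.algebraMap_apply R C, IsScalarTower.algebraMap_apply R S C]
      rfl
  have : IsScalarTower R S (C ⧸ q.map (algebraMap S C)) :=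
    .of_algebraMap_eq fun r ↦ by
      rw [IsScalarTower.algebraMap_apply R C, IsScalarTower.algebraMap_apply R S C]
      rfl
  have : IsScalarTower R (R ⧸ m) (C ⧸ q.map (algebraMap S C)) :=
    .of_algebraMap_eq fun r ↦ by
      rw [IsScalarTower.algebraMap_apply R C, IsScalarTower.algebraMap_apply R S C]
      rfl
  have : IsScalarTower R (A ⧸ m.map (algebraMap R A)) (C ⧸ q.map (algebraMap S C)) :=
    .of_algebraMap_eq fun r ↦ by
      rw [IsScalarTower.algebraMap_apply R C, IsScalarTower.algebraMap_apply R A C]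
      rfl
  have : IsScalarTower (R ⧸ m) (A ⧸ m.map (algebraMap R A)) (C ⧸ q.map (algebraMap S C)) :=
    .of_algebraMap_eq fun r ↦ by
      obtain ⟨r, rfl⟩ := Ideal.Quotient.mk_surjective r
      change algebraMap (R ⧸ m) _ (algebraMap R (R ⧸ m) r) =
        algebraMap (A ⧸ m.map (algebraMap R A)) _ (algebraMap (R ⧸ m) _ (algebraMap R (R ⧸ m) r))
      simp only [← IsScalarTower.algebraMap_apply]
  have := Algebra.IsPushout.of_cube R S A C (R ⧸ m) (S ⧸ q) (A ⧸ m.map (algebraMap R A))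
    (C ⧸ q.map (algebraMap S C))
  have : Module.FaithfullyFlat (R ⧸ m) (S ⧸ q) := faithfullyFlat_quotient m q
  exact Algebra.IsPushout.faithfullyFlat (R ⧸ m) (S ⧸ q) _ _

end Fiber

end Unramified

/-! ### Ramification indices, local generators, and the flatness argument detecting ramification. -/

section Extension

/-- The index is the length of `S_q ⧸ m S_q`, with infinite length read as `0`; the value `1`
therefore means that this quotient is simple. -/
lemma Ideal.map_eq_maximalIdeal_of_ramificationIdx_eq_one {R S : Type*} [CommRing R] [CommRing S]
    [Algebra R S] {m : Ideal R} {q : Ideal S} [q.IsPrime] [q.LiesOver m]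
    (h : q.ramificationIdx R = 1) :
    m.map (algebraMap R (Localization.AtPrime q)) = maximalIdeal (Localization.AtPrime q) := by
  rw [Ideal.ramificationIdx_eq m, ENat.toNat_eq_iff_eq_natCast, Nat.cast_one,
    Module.length_eq_one_iff, isSimpleModule_iff_isCoatom, ← Ideal.isMaximal_def,
    IsLocalRing.isMaximal_iff] at h
  exact h

lemma Ideal.ramificationIdx_eq_one_of_map_eq_maximalIdeal {R S : Type*} [CommRing R] [CommRing S]
    [Algebra R S] {m : Ideal R} {q : Ideal S} [q.IsPrime] [q.LiesOver m]
    (h : m.map (algebraMap R (Localization.AtPrime q)) = maximalIdeal (Localization.AtPrime q)) :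
    q.ramificationIdx R = 1 := by
  rw [Ideal.ramificationIdx_eq m, ENat.toNat_eq_iff_eq_natCast, Nat.cast_one,
    Module.length_eq_one_iff, isSimpleModule_iff_isCoatom, ← Ideal.isMaximal_def,
    IsLocalRing.isMaximal_iff]
  exact h

lemma Algebra.FormallyUnramified.of_isSeparable_quotient {R S : Type*} [CommRing R] [CommRing S]
    [Algebra R S] (m : Ideal R) (q : Ideal S) [m.IsMaximal] [q.IsMaximal] [q.LiesOver m]
    [Algebra.IsSeparable (R ⧸ m) (S ⧸ q)] : Algebra.FormallyUnramified R (S ⧸ q) := by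
  have h : Algebra.FormallyUnramified (R ⧸ m) (S ⧸ q) := by
    let := Ideal.Quotient.field m
    let := Ideal.Quotient.field q
    exact .of_isSeparable _ _
  exact .comp R (R ⧸ m) _

lemma Algebra.isUnramifiedAt_of_ramificationIdx_eq_one {R S : Type*} [CommRing R] [CommRing S]
    [Algebra R S] [Algebra.EssFiniteType R S] (m : Ideal R) (q : Ideal S) [m.IsMaximal]
    [q.IsMaximal] [q.LiesOver m]
    [Algebra.IsSeparable (R ⧸ m) (S ⧸ q)] (h : q.ramificationIdx R = 1) :
    Algebra.IsUnramifiedAt R q := by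
  let := Localization.AtPrime.algebraOfLiesOver m q
  rw [Algebra.isUnramifiedAt_iff_map_eq R m q]
  refine ⟨?_, Ideal.map_eq_maximalIdeal_of_ramificationIdx_eq_one h⟩
  -- Separability is moved from `S ⧸ q` over `R ⧸ m` to the residue fields through formal
  -- unramifiedness over `R`.
  have : Algebra.FormallyUnramified R (S ⧸ q) := .of_isSeparable_quotient m q
  have : Algebra.FormallyUnramified (S ⧸ q) q.ResidueField :=
    .of_equiv (AlgEquiv.ofBijective (Algebra.ofId (S ⧸ q) q.ResidueField)
      q.bijective_algebraMap_quotient_residueField)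
  have : Algebra.FormallyUnramified R q.ResidueField := .comp R (S ⧸ q) _
  have : Algebra.FormallyUnramified m.ResidueField q.ResidueField := .of_restrictScalars R _ _
  have : Algebra.EssFiniteType R q.ResidueField := .comp _ S _
  have : Algebra.EssFiniteType m.ResidueField q.ResidueField := .of_comp R _ _
  exact Algebra.FormallyUnramified.isSeparable _ _

/-- The local ring of `S` at `⊥` is `L`, and `R → K → L` is a localization followed by a separable
extension. -/
lemma Algebra.isUnramifiedAt_bot_of_isSeparable (R K L S : Type*) [CommRing R] [IsDomain R]
    [Field K] [Algebra R K] [IsFractionRing R K]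
    [Field L] [Algebra K L] [Algebra.IsSeparable K L]
    [Algebra R L] [IsScalarTower R K L]
    [CommRing S] [IsDomain S] [Algebra R S] [Algebra S L] [IsScalarTower R S L]
    [IsFractionRing S L] : Algebra.IsUnramifiedAt R (⊥ : Ideal S) := by
  have : Algebra.FormallyUnramified R K := .of_isLocalization (nonZeroDivisors R)
  have : Algebra.FormallyUnramified K L := .of_isSeparable K L
  have : Algebra.FormallyUnramified R L := .comp R K L
  have : IsLocalization (nonZeroDivisors S) (Localization.AtPrime (⊥ : Ideal S)) := by
    simpa [Ideal.primeCompl_bot] using Localization.isLocalization (M := (⊥ : Ideal S).primeCompl)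
  exact .of_equiv ((IsLocalization.algEquiv (nonZeroDivisors S) L
    (Localization.AtPrime (⊥ : Ideal S))).restrictScalars R)

lemma Ideal.liesOver_maximalIdeal_of_ne_bot {R S : Type*} [CommRing R] [IsDomain R]
    [IsDiscreteValuationRing R] [CommRing S] [IsDomain S] [Algebra R S] [Algebra.IsIntegral R S]
    {q : Ideal S} [q.IsPrime] (hq : q ≠ ⊥) : q.LiesOver (maximalIdeal R) := by
  have h : q.under R ≠ ⊥ := fun h ↦ hq (Ideal.eq_bot_of_comap_eq_bot h)
  have : (q.under R).IsMaximal := Ideal.IsPrime.isMaximal inferInstance h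
  exact ⟨(eq_maximalIdeal this).symm⟩

/-- A nonzero prime of a Dedekind domain is locally generated by one of its elements. -/
lemma IsDedekindDomain.exists_map_eq_span_singleton {S : Type*} [CommRing S]
    [IsDedekindDomain S] {q : Ideal S} [q.IsPrime] (hq : q ≠ ⊥) :
    ∃ t ∈ q, t ≠ 0 ∧ q.map (algebraMap S (Localization.AtPrime q)) =
      Ideal.span {algebraMap S (Localization.AtPrime q) t} := by
  have := IsLocalization.AtPrime.isDiscreteValuationRing_of_dedekind_domain S hq
    (Localization.AtPrime q)
  obtain ⟨w, hw⟩ := IsDiscreteValuationRing.exists_irreducible (Localization.AtPrime q)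
  -- Clearing the unit denominator of a uniformizer leaves a generator coming from `S`.
  obtain ⟨t, s, rfl⟩ := IsLocalization.exists_mk'_eq q.primeCompl w
  have h1 : maximalIdeal (Localization.AtPrime q) =
      Ideal.span {algebraMap S (Localization.AtPrime q) t} := by
    rw [hw.maximalIdeal_eq, Ideal.span_singleton_eq_span_singleton]
    refine ⟨(IsLocalization.map_units (Localization.AtPrime q) s).unit, ?_⟩
    exact IsLocalization.mk'_spec _ t s
  refine ⟨t, ?_, ?_, by rw [Localization.AtPrime.map_eq_maximalIdeal, h1]⟩
  · have : algebraMap S (Localization.AtPrime q) t ∈ maximalIdeal (Localization.AtPrime q) :=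
      h1 ▸ Ideal.mem_span_singleton_self _
    exact (IsLocalization.AtPrime.to_map_mem_maximal_iff _ q t).mp this
  · rintro rfl
    exact hw.ne_zero (by simp)

/-- The equational criterion for flatness, applied to a relation with a single term. -/
lemma Module.Flat.exists_eq_sum_of_smul_eq_zero {B M : Type*} [CommRing B] [AddCommGroup M]
    [Module B M] [Module.Flat B M] {b : B} {x : M} (h : b • x = 0) :
    ∃ (n : ℕ) (a : Fin n → B) (y : Fin n → M), x = ∑ j, a j • y j ∧ ∀ j, b * a j = 0 := by
  obtain ⟨n, a, y, hy, ha⟩ := Module.Flat.isTrivialRelation_of_sum_smul_eq_zero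
    (ι := Unit) (f := fun _ ↦ b) (x := fun _ ↦ x) (by simpa using h)
  exact ⟨n, a (), y, hy (), fun j ↦ by simpa using ha j⟩

/-- If `q` is a prime of `S`, `p` a prime of `A`, both under a prime `P` of `C = S ⊗[R] A` and
over a maximal ideal `m` of `R`, then an element of `S` in `p C_P` already lies in `m S_q`. -/
lemma Algebra.IsPushout.mem_map_of_mem_map {R S A C : Type*} [CommRing R] [CommRing S] [CommRing A]
    [CommRing C] [Algebra R S] [Algebra R A] [Algebra R C] [Algebra S C] [Algebra A C]
    [IsScalarTower R S C] [IsScalarTower R A C] [Algebra.IsPushout R S A C]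
    (m : Ideal R) [m.IsMaximal] (q : Ideal S) [q.IsPrime] (p : Ideal A) [p.IsPrime] [p.LiesOver m]
    (P : Ideal C) [P.IsPrime] [P.LiesOver q] [P.LiesOver p] {t : S}
    (ht : algebraMap S (Localization.AtPrime P) t ∈
      p.map (algebraMap A (Localization.AtPrime P))) :
    algebraMap S (Localization.AtPrime q) t ∈ m.map (algebraMap R (Localization.AtPrime q)) := by
  have : Algebra.IsPushout R A S C := .symm ‹_›
  -- `S` and `A` exchange roles: `C ⧸ pC` is flat over `S ⧸ mS`.
  let := quotientMapAlgebra (A := S) (C := C) m p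
  have := faithfullyFlat_quotientMapAlgebra (A := S) (C := C) m p
  rw [IsScalarTower.algebraMap_eq A C, ← Ideal.map_map, IsScalarTower.algebraMap_apply S C,
    IsLocalization.algebraMap_mem_map_algebraMap_iff P.primeCompl] at ht
  obtain ⟨c, hc, hct⟩ := ht
  rw [IsScalarTower.algebraMap_eq R S, ← Ideal.map_map,
    IsLocalization.algebraMap_mem_map_algebraMap_iff q.primeCompl]
  have hpP : p.map (algebraMap A C) ≤ P := Ideal.map_le_of_le_comap (Ideal.over_def P p).le
  have halg (s : S) : algebraMap (S ⧸ m.map (algebraMap R S)) (C ⧸ p.map (algebraMap A C))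
      (Ideal.Quotient.mk _ s) = Ideal.Quotient.mk _ (algebraMap S C s) := rfl
  have hrel : (Ideal.Quotient.mk (m.map (algebraMap R S)) t) •
      (Ideal.Quotient.mk (p.map (algebraMap A C)) c) = 0 := by
    rw [Algebra.smul_def, mul_comm, halg, ← map_mul]
    exact Ideal.Quotient.eq_zero_iff_mem.mpr hct
  -- Some `c ∉ P` satisfies `c t ∈ pC`. Flatness writes `c` modulo `pC` as a combination of elements
  -- of `S` killing `t` modulo `mS`. If all of these lay in `q`, then `c` would lie in `P`; one
  -- outside `q` puts `t` in `m S_q`.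
  obtain ⟨n, a, y, hy, ha⟩ := Module.Flat.exists_eq_sum_of_smul_eq_zero
    (B := S ⧸ m.map (algebraMap R S)) (M := C ⧸ p.map (algebraMap A C)) hrel
  choose s hs using fun j ↦ Ideal.Quotient.mk_surjective (a j)
  choose z hz using fun j ↦ Ideal.Quotient.mk_surjective (y j)
  by_contra! hcon
  have hsq (j) : s j ∈ q := by
    by_contra hj
    refine hcon (s j) hj ?_
    rw [mul_comm, ← Ideal.Quotient.eq_zero_iff_mem, map_mul, hs]
    exact ha j
  have h0 : c - ∑ j, algebraMap S C (s j) * z j ∈ p.map (algebraMap A C) := by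
    rw [← Ideal.Quotient.eq_zero_iff_mem, map_sub, map_sum, sub_eq_zero, hy]
    refine Finset.sum_congr rfl fun j _ ↦ ?_
    rw [Algebra.smul_def, ← hs, ← hz, map_mul, halg]
  refine hc ?_
  have h1 : ∑ j, algebraMap S C (s j) * z j ∈ P := sum_mem fun j _ ↦
    P.mul_mem_right _ ((Ideal.over_def P q).le (hsq j))
  simpa using add_mem (hpP h0) h1

end Extension

/-! ### Regularity of `C = S ⊗[R] A` against regularity of its fibres. -/

section BaseChange

/-- For a surjection `f : C → E`, the local ring of `E` at a prime is the quotient of the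
corresponding local ring of `C` by the ideal generated by the kernel of `f`. -/
lemma Localization.exists_surjective_ker_eq_map {C E : Type*} [CommRing C] [CommRing E]
    [Algebra C E] (hf : Function.Surjective (algebraMap C E)) (P : Ideal C) [P.IsPrime]
    (Q : Ideal E) [Q.IsPrime] [Q.LiesOver P] :
    ∃ g : Localization.AtPrime P →ₐ[C] Localization.AtPrime Q, Function.Surjective g ∧
      RingHom.ker (g : Localization.AtPrime P →+* Localization.AtPrime Q) =
        (RingHom.ker (algebraMap C E)).map (algebraMap C (Localization.AtPrime P)) := by
  have hM : P.primeCompl.map (algebraMap C E) = Q.primeCompl := by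
    ext x
    simp only [Submonoid.mem_map, Ideal.mem_primeCompl_iff]
    constructor
    · rintro ⟨y, hy, rfl⟩
      rwa [Ideal.over_def Q P, Ideal.mem_comap] at hy
    · intro hx
      obtain ⟨y, rfl⟩ := hf x
      exact ⟨y, by rwa [Ideal.over_def Q P, Ideal.mem_comap], rfl⟩
  have : IsLocalization (P.primeCompl.map (algebraMap C E)) (Localization.AtPrime Q) := by
    rw [hM]; infer_instance
  refine ⟨⟨IsLocalization.map (Localization.AtPrime Q) (algebraMap C E)
    (P.primeCompl.le_comap_map.trans (by rw [hM])), fun c ↦ ?_⟩, ?_, ?_⟩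
  · exact (IsLocalization.map_eq _ c).trans (IsScalarTower.algebraMap_apply C E _ c).symm
  · exact IsLocalization.map_surjective_of_surjective P.primeCompl _ _ hf
  · exact IsLocalization.ker_map _ (algebraMap C E) hM

variable {R S A C : Type*} [CommRing R] [CommRing S] [CommRing A] [CommRing C] [Algebra R S]
  [Algebra R A] [Algebra R C] [Algebra S C] [Algebra A C] [IsScalarTower R S C]
  [IsScalarTower R A C] [Algebra.IsPushout R S A C]

attribute [local instance] quotientMapAlgebra

include R A in
lemma Algebra.IsPushout.finite_quotient [Module.Finite R S] (q : Ideal S) :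
    Module.Finite A (C ⧸ q.map (algebraMap S C)) :=
  have : Module.Finite A C := Algebra.IsPushout.finite R S A C
  .of_surjective (Algebra.linearMap C (C ⧸ q.map (algebraMap S C)) |>.restrictScalars A)
    Ideal.Quotient.mk_surjective

/-- `C ⧸ qC` is the base change to `A` of `S ⧸ q`, which is formally unramified over `R` by
separability. -/
lemma Algebra.IsPushout.isUnramifiedAt_quotient (m : Ideal R) [m.IsMaximal] (q : Ideal S)
    [q.IsMaximal] [q.LiesOver m] [Algebra.IsSeparable (R ⧸ m) (S ⧸ q)]
    (Q : Ideal (C ⧸ q.map (algebraMap S C))) [Q.IsPrime] : Algebra.IsUnramifiedAt A Q := by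
  have : Algebra.FormallyUnramified R (S ⧸ q) := .of_isSeparable_quotient m q
  have := Algebra.IsPushout.quotient S C q
  have : IsScalarTower R S (C ⧸ q.map (algebraMap S C)) :=
    .of_algebraMap_eq fun r ↦ by
      rw [IsScalarTower.algebraMap_apply R C, IsScalarTower.algebraMap_apply R S C]
      rfl
  have : IsScalarTower R (S ⧸ q) (C ⧸ q.map (algebraMap S C)) :=
    .of_algebraMap_eq fun r ↦ by
      rw [IsScalarTower.algebraMap_apply R S]
      rfl
  have : Algebra.IsPushout R (S ⧸ q) A (C ⧸ q.map (algebraMap S C)) :=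
    (Algebra.IsPushout.comp_iff R S A (S' := C)).mpr inferInstance
  have : Algebra.FormallyUnramified A (C ⧸ q.map (algebraMap S C)) :=
    Algebra.IsPushout.formallyUnramified R (S ⧸ q) A _
  have : Algebra.FormallyUnramified (C ⧸ q.map (algebraMap S C)) (Localization.AtPrime Q) :=
    .of_isLocalization Q.primeCompl
  exact Algebra.FormallyUnramified.comp _ (C ⧸ q.map (algebraMap S C)) _

/-- Regularity passes between `A ⧸ mA` and `C ⧸ qC` if the residue extension at `q` is
separable. -/
lemma isRegularLocalRing_iff_quotientMapAlgebra [Module.Finite R S] [IsNoetherianRing A]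
    (m : Ideal R) [m.IsMaximal] (q : Ideal S) [q.IsMaximal] [q.LiesOver m]
    [Algebra.IsSeparable (R ⧸ m) (S ⧸ q)]
    (Q : Ideal (C ⧸ q.map (algebraMap S C))) [Q.IsPrime] :
    IsRegularLocalRing (Localization.AtPrime
      (Q.comap (algebraMap (A ⧸ m.map (algebraMap R A)) (C ⧸ q.map (algebraMap S C))))) ↔
    IsRegularLocalRing (Localization.AtPrime Q) := by
  have : Module.FaithfullyFlat (A ⧸ m.map (algebraMap R A)) (C ⧸ q.map (algebraMap S C)) :=
    faithfullyFlat_quotientMapAlgebra m q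
  have : IsScalarTower A (A ⧸ m.map (algebraMap R A)) (C ⧸ q.map (algebraMap S C)) :=
    .of_algebraMap_eq fun _ ↦ rfl
  have : Module.Finite A (C ⧸ q.map (algebraMap S C)) :=
    Algebra.IsPushout.finite_quotient (R := R) q
  have : Module.Finite (A ⧸ m.map (algebraMap R A)) (C ⧸ q.map (algebraMap S C)) :=
    .of_restrictScalars_finite A _ _
  have : IsNoetherianRing (C ⧸ q.map (algebraMap S C)) := .of_finite A _
  have : Algebra.IsUnramifiedAt A Q := Algebra.IsPushout.isUnramifiedAt_quotient m q Q
  have : Algebra.IsUnramifiedAt (A ⧸ m.map (algebraMap R A)) Q :=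
    Algebra.FormallyUnramified.of_restrictScalars A _ _
  have : Q.LiesOver (Q.comap (algebraMap (A ⧸ m.map (algebraMap R A))
    (C ⧸ q.map (algebraMap S C)))) := ⟨rfl⟩
  exact Algebra.IsUnramifiedAt.isRegularLocalRing_iff _ Q

/-- If `S` is unramified over `R` at `q`, then regularity ascends to `C = S ⊗[R] A`. -/
lemma IsRegularLocalRing.of_isUnramifiedAt [Module.Finite R S] [Module.Flat R S]
    [IsRegularRing A] (q : Ideal S) [q.IsPrime] (P : Ideal C) [P.IsPrime] [P.LiesOver q]
    [Algebra.IsUnramifiedAt R q] : IsRegularLocalRing (Localization.AtPrime P) := by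
  have : Module.Finite A C := Algebra.IsPushout.finite R S A C
  have : Module.Flat A C := Algebra.IsPushout.flat R S A C
  have : IsNoetherianRing C := .of_finite A _
  have := Algebra.IsPushout.isUnramifiedAt R S A C q P
  rw [← Algebra.IsUnramifiedAt.isRegularLocalRing_iff (P.under A) P]
  infer_instance

theorem IsRegularRing.of_forall_isUnramifiedAt [Module.Finite R S] [Module.Flat R S]
    [IsRegularRing A] (h : ∀ (q : Ideal S) [q.IsPrime], Algebra.IsUnramifiedAt R q) :
    IsRegularRing C := by
  have : Module.Finite A C := Algebra.IsPushout.finite R S A C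
  have : IsNoetherianRing C := .of_finite A _
  rw [isRegularRing_iff]
  intro P _
  have := h (P.under S)
  exact .of_isUnramifiedAt (R := R) (A := A) (P.under S) P

lemma map_eq_span_singleton_of_liesOver {q : Ideal S} [q.IsPrime] {t : S}
    (h : q.map (algebraMap S (Localization.AtPrime q)) =
      Ideal.span {algebraMap S (Localization.AtPrime q) t}) (P : Ideal C) [P.IsPrime]
    [P.LiesOver q] : q.map (algebraMap S (Localization.AtPrime P)) =
      Ideal.span {algebraMap S (Localization.AtPrime P) t} := by
  let := Localization.AtPrime.algebraOfLiesOver q P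
  rw [IsScalarTower.algebraMap_eq S (Localization.AtPrime q) (Localization.AtPrime P),
    ← Ideal.map_map, h, Ideal.map_span, Set.image_singleton]
  rfl

variable [IsDedekindDomain S]

/-- `C = S ⊗[R] A` is regular at a prime `P` over `q ≠ 0` if the special fibre of `A` is regular
and the residue field extension at `q` is separable. -/
lemma IsRegularLocalRing.of_isRegularRing_quotient [Module.Finite R S] [IsNoetherianRing A]
    [Module.Flat R A] (m : Ideal R) [m.IsMaximal] [IsRegularRing (A ⧸ m.map (algebraMap R A))]
    (q : Ideal S) [q.IsPrime] (hq : q ≠ ⊥) [q.LiesOver m]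
    [Algebra.IsSeparable (R ⧸ m) (S ⧸ q)] (P : Ideal C) [P.IsPrime] [P.LiesOver q] :
    IsRegularLocalRing (Localization.AtPrime P) := by
  have : q.IsMaximal := Ideal.IsPrime.isMaximal ‹_› hq
  have : Module.Finite A C := Algebra.IsPushout.finite R S A C
  have : IsNoetherianRing C := .of_finite A _
  have hqP : q.map (algebraMap S C) ≤ P := Ideal.map_le_of_le_comap (Ideal.over_def P q).le
  let Q : Ideal (C ⧸ q.map (algebraMap S C)) := P.map (Ideal.Quotient.mk _)
  have : Q.IsPrime := Ideal.isPrime_map_quotientMk_of_isPrime hqP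
  have : Q.LiesOver P := ⟨by
    rw [Ideal.under_def, Ideal.Quotient.algebraMap_eq,
      Ideal.comap_map_of_surjective' _ Ideal.Quotient.mk_surjective, Ideal.mk_ker,
      sup_of_le_left hqP]⟩
  have hreg : IsRegularLocalRing (Localization.AtPrime Q) :=
    (isRegularLocalRing_iff_quotientMapAlgebra m q Q (R := R) (A := A)).mp inferInstance
  obtain ⟨g, hg, hker⟩ := Localization.exists_surjective_ker_eq_map
    (Ideal.Quotient.mk_surjective (I := q.map (algebraMap S C))) P Q
  obtain ⟨t, htq, ht0, ht⟩ := IsDedekindDomain.exists_map_eq_span_singleton hq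
  rw [Ideal.Quotient.algebraMap_eq, Ideal.mk_ker, Ideal.map_map, ← IsScalarTower.algebraMap_eq,
    map_eq_span_singleton_of_liesOver ht P] at hker
  -- The local ring of the fibre `C ⧸ qC` is `C_P ⧸ (t)`.
  have e := (Ideal.quotEquivOfEq hker).symm.trans (RingHom.quotientKerEquivOfSurjective hg)
  have := IsRegularLocalRing.of_ringEquiv e.symm
  have : Module.Flat S C := have : Algebra.IsPushout R A S C := .symm ‹_›
    Algebra.IsPushout.flat R A S C
  have : Module.Flat S (Localization.AtPrime P) := .trans S C _
  refine .of_quotient_span_singleton (t := algebraMap S (Localization.AtPrime P) t) ?_ ?_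
  · rw [IsScalarTower.algebraMap_apply S C]
    exact (IsLocalization.AtPrime.to_map_mem_maximal_iff _ P _).mpr
      ((Ideal.over_def P q).le htq)
  -- `t ≠ 0` in the domain `S` stays a nonzerodivisor because `C_P` is flat over `S`.
  · have hr : IsSMulRegular (Localization.AtPrime P) (algebraMap S (Localization.AtPrime P) t) :=
      (IsSMulRegular.of_flat (R := S) (x := t) fun a b h ↦ mul_left_cancel₀ ht0 h)
    rw [mem_nonZeroDivisors_iff_left]
    exact fun z hz ↦ hr (hz.trans (smul_zero _).symm)

/-- If `C = S ⊗[R] A` is regular, then the special fibre of `A` is regular if `S` has a ramified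
prime with separable residue field extension. -/
theorem IsRegularRing.quotient_of_ramificationIdx_ne_one [Module.Finite R S] [IsNoetherianRing A]
    (m : Ideal R) [m.IsMaximal] (q : Ideal S) [q.IsPrime] (hq : q ≠ ⊥) [q.LiesOver m]
    [Algebra.IsSeparable (R ⧸ m) (S ⧸ q)] (he : q.ramificationIdx R ≠ 1) [IsRegularRing C] :
    IsRegularRing (A ⧸ m.map (algebraMap R A)) := by
  rw [isRegularRing_iff]
  intro p₀ _
  have : q.IsMaximal := Ideal.IsPrime.isMaximal ‹_› hq
  have : Module.FaithfullyFlat (A ⧸ m.map (algebraMap R A)) (C ⧸ q.map (algebraMap S C)) :=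
    faithfullyFlat_quotientMapAlgebra m q
  -- Faithful flatness puts a prime of `C ⧸ qC` above each prime of `A ⧸ mA`, where regularity can
  -- be tested instead.
  obtain ⟨⟨Q, _⟩, hQ⟩ := PrimeSpectrum.comap_surjective_of_faithfullyFlat
    (A := A ⧸ m.map (algebraMap R A)) (B := C ⧸ q.map (algebraMap S C)) ⟨p₀, ‹_›⟩
  obtain rfl : Q.comap (algebraMap (A ⧸ m.map (algebraMap R A)) (C ⧸ q.map (algebraMap S C))) = p₀ :=
    congrArg PrimeSpectrum.asIdeal hQ
  rw [isRegularLocalRing_iff_quotientMapAlgebra m q Q (R := R) (A := A)]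
  let P : Ideal C := Q.under C
  have : P.IsPrime := inferInstance
  have : Q.LiesOver P := ⟨rfl⟩
  have hqP : q.map (algebraMap S C) ≤ P := by
    rw [← Ideal.mk_ker (I := q.map (algebraMap S C))]
    exact Ideal.comap_mono bot_le
  have : P.LiesOver q := ⟨(Ideal.IsMaximal.eq_of_le ‹_› (Ideal.IsPrime.under S P).ne_top
    (Ideal.map_le_iff_le_comap.mp hqP))⟩
  let p : Ideal A := P.under A
  have : P.LiesOver p := ⟨rfl⟩
  have : P.LiesOver m := .trans P q m
  have : p.LiesOver m := .tower_bot P p m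
  have : Q.LiesOver p := .trans Q P p
  have : Module.Finite A (C ⧸ q.map (algebraMap S C)) :=
    Algebra.IsPushout.finite_quotient (R := R) q
  obtain ⟨g, hg, hker⟩ := Localization.exists_surjective_ker_eq_map
    (Ideal.Quotient.mk_surjective (I := q.map (algebraMap S C))) P Q
  obtain ⟨t, htq, -, ht⟩ := IsDedekindDomain.exists_map_eq_span_singleton hq
  rw [Ideal.Quotient.algebraMap_eq, Ideal.mk_ker, Ideal.map_map, ← IsScalarTower.algebraMap_eq,
    map_eq_span_singleton_of_liesOver ht P] at hker
  have e := (Ideal.quotEquivOfEq hker).symm.trans (RingHom.quotientKerEquivOfSurjective hg)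
  have htP : algebraMap S (Localization.AtPrime P) t ∈ maximalIdeal (Localization.AtPrime P) := by
    rw [IsScalarTower.algebraMap_apply S C]
    exact (IsLocalization.AtPrime.to_map_mem_maximal_iff _ P _).mpr
      ((Ideal.over_def P q).le htq)
  suffices ht2 : algebraMap S (Localization.AtPrime P) t ∉
      maximalIdeal (Localization.AtPrime P) ^ 2 by
    have := IsRegularLocalRing.quotient_span_singleton htP ht2
    exact IsRegularLocalRing.of_ringEquiv e
  intro ht2
  have : Algebra.IsUnramifiedAt A Q := Algebra.IsPushout.isUnramifiedAt_quotient m q Q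
  -- `C ⧸ qC` is unramified over `A`, so `p` generates the maximal ideal of `C_P ⧸ (t)`.
  have hmax : maximalIdeal (Localization.AtPrime P) =
      p.map (algebraMap A (Localization.AtPrime P)) ⊔
        Ideal.span {algebraMap S (Localization.AtPrime P) t} := by
    let := Localization.AtPrime.algebraOfLiesOver p Q
    have h := ((Algebra.isUnramifiedAt_iff_map_eq A p Q).mp ‹_›).2
    have hgA : algebraMap A (Localization.AtPrime Q) =
        (g : Localization.AtPrime P →+* Localization.AtPrime Q).comp
          (algebraMap A (Localization.AtPrime P)) := by
      rw [IsScalarTower.algebraMap_eq A C (Localization.AtPrime P), ← RingHom.comp_assoc,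
        AlgHom.comp_algebraMap, ← IsScalarTower.algebraMap_eq]
    rw [hgA, ← Ideal.map_map] at h
    rw [← hker, ← Ideal.comap_map_of_surjective'
      (g : Localization.AtPrime P →+* Localization.AtPrime Q) hg, h]
    have := Ideal.comap_isMaximal_of_surjective
      (g : Localization.AtPrime P →+* Localization.AtPrime Q) hg
      (K := maximalIdeal (Localization.AtPrime Q))
    exact (eq_maximalIdeal this).symm
  -- With `t` in the square of the maximal ideal, Nakayama removes it from the generators.
  have hle : maximalIdeal (Localization.AtPrime P) ≤
      p.map (algebraMap A (Localization.AtPrime P)) := by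
    have : IsNoetherianRing (Localization.AtPrime P) := inferInstance
    refine Submodule.le_of_le_smul_of_le_jacobson_bot
      (maximalIdeal (Localization.AtPrime P)).fg_of_isNoetherianRing (maximalIdeal_le_jacobson _) ?_
    rw [smul_eq_mul, ← sq]
    conv_lhs => rw [hmax]
    exact sup_le_sup_left ((Ideal.span_singleton_le_iff_mem _).mpr ht2) _
  have htm := Algebra.IsPushout.mem_map_of_mem_map m q p P (hle htP)
  refine he (Ideal.ramificationIdx_eq_one_of_map_eq_maximalIdeal (m := m) (le_antisymm ?_ ?_))
  · rw [IsScalarTower.algebraMap_eq R S, ← Ideal.map_map, ← Localization.AtPrime.map_eq_maximalIdeal]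
    exact Ideal.map_mono (Ideal.map_le_of_le_comap (Ideal.over_def q m).le)
  · rw [← Localization.AtPrime.map_eq_maximalIdeal, ht]
    exact (Ideal.span_singleton_le_iff_mem _).mpr htm

end BaseChange

/-! ### Passage from schemes to affine charts. -/

namespace BaseChangeRegularity

open TensorProduct

lemma isRegularLocalRing_stalk_iff {X Y : Scheme.{u}} (f : X ⟶ Y) [IsOpenImmersion f] (x : X) :
    IsRegularLocalRing (Y.presheaf.stalk (f x)) ↔ IsRegularLocalRing (X.presheaf.stalk x) :=
  let e := (asIso (f.stalkMap x)).commRingCatIsoToRingEquiv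
  ⟨fun _ ↦ .of_ringEquiv e, fun _ ↦ .of_ringEquiv e.symm⟩

lemma isRegularScheme_iff_openCover {X : Scheme.{u}} (𝒰 : X.OpenCover) :
    IsRegularScheme X ↔ ∀ i, IsRegularScheme (𝒰.X i) := by
  refine ⟨fun h i x ↦ (isRegularLocalRing_stalk_iff (𝒰.f i) x).mp (h _), fun h x ↦ ?_⟩
  obtain ⟨i, y, rfl⟩ := 𝒰.exists_eq x
  exact (isRegularLocalRing_stalk_iff (𝒰.f i) y).mpr (h i y)

lemma isRegularScheme_iff_of_iso {X Y : Scheme.{u}} (e : X ≅ Y) :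
    IsRegularScheme X ↔ IsRegularScheme Y := by
  refine ⟨fun h y ↦ ?_, fun h x ↦ (isRegularLocalRing_stalk_iff e.hom x).mp (h _)⟩
  exact (isRegularLocalRing_stalk_iff e.inv y).mp (h _)

lemma isRegularScheme_Spec_iff {A : Type u} [CommRing A] [IsNoetherianRing A] :
    IsRegularScheme (Spec (CommRingCat.of A)) ↔ IsRegularRing A := by
  have key (x : PrimeSpectrum A) :
      IsRegularLocalRing ((Spec (CommRingCat.of A)).presheaf.stalk x) ↔
        IsRegularLocalRing (Localization.AtPrime x.asIdeal) :=
    let : Algebra A ((Spec (CommRingCat.of A)).presheaf.stalk x) := StructureSheaf.stalkAlgebra A x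
    have : IsLocalization.AtPrime ((Spec (CommRingCat.of A)).presheaf.stalk x) x.asIdeal :=
      StructureSheaf.IsLocalization.to_stalk A x
    let e := (IsLocalization.algEquiv x.asIdeal.primeCompl (Localization.AtPrime x.asIdeal)
      ((Spec (CommRingCat.of A)).presheaf.stalk x)).toRingEquiv
    ⟨fun _ ↦ .of_ringEquiv e.symm, fun _ ↦ .of_ringEquiv e⟩
  rw [isRegularRing_iff]
  exact ⟨fun h p hp ↦ (key ⟨p, hp⟩).mp (h _), fun h (x : PrimeSpectrum A) ↦ (key x).mpr (h x.asIdeal)⟩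

lemma isRegularScheme_baseChange_iff_openCover {R : Type u} [CommRing R] {X : Scheme.{u}}
    (𝒰 : X.OpenCover) (f : X ⟶ Spec (CommRingCat.of R)) (T : Type u) [CommRing T] [Algebra R T] :
    IsRegularScheme (baseChange f T) ↔ ∀ i, IsRegularScheme (baseChange (𝒰.f i ≫ f) T) :=
  isRegularScheme_iff_openCover (Scheme.Pullback.openCoverOfLeft 𝒰 f _)

lemma isRegularScheme_baseChange_Spec_iff {R A T : Type u} [CommRing R] [CommRing A] [CommRing T]
    [Algebra R A] [Algebra R T] [IsNoetherianRing A] [Module.Finite R T] :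
    IsRegularScheme (baseChange (Spec.map (CommRingCat.ofHom (algebraMap R A))) T) ↔
      IsRegularRing (A ⊗[R] T) := by
  have : IsNoetherianRing (A ⊗[R] T) := .of_finite A _
  rw [isRegularScheme_iff_of_iso (pullbackSpecIso R A T), isRegularScheme_Spec_iff]

section Affine

variable {R S A : Type u} [CommRing R] [IsDomain R] [IsDiscreteValuationRing R] [CommRing S]
  [IsDedekindDomain S] [Algebra R S] [Module.Finite R S] [FaithfulSMul R S] [CommRing A]
  [Algebra R A] [IsRegularRing A]

omit [IsDedekindDomain S] [Module.Finite R S] in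
lemma ne_bot_of_liesOver_maximalIdeal (q : Ideal S) [q.LiesOver (maximalIdeal R)] : q ≠ ⊥ := by
  rintro rfl
  refine IsDiscreteValuationRing.not_a_field R ?_
  rw [Ideal.over_def (⊥ : Ideal S) (maximalIdeal R), Ideal.under_def]
  exact (RingHom.injective_iff_ker_eq_bot _).mp (FaithfulSMul.algebraMap_injective R S)

variable (A) in
lemma isRegularRing_tensorProduct_of_isUnramified (h0 : Algebra.IsUnramifiedAt R (⊥ : Ideal S))
    (h : IsUnramified R S) : IsRegularRing (A ⊗[R] S) := by
  let : Algebra S (A ⊗[R] S) := Algebra.TensorProduct.rightAlgebra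
  have : Module.Flat R S := inferInstance
  have : Algebra.IsPushout R S A (A ⊗[R] S) := inferInstance
  refine .of_forall_isUnramifiedAt (R := R) (S := S) (A := A) fun q _ ↦ ?_
  by_cases hq : q = ⊥
  · subst hq; exact h0
  have := Ideal.liesOver_maximalIdeal_of_ne_bot (R := R) hq
  have : q.IsMaximal := Ideal.IsPrime.isMaximal ‹_› hq
  have := h.2 q
  exact Algebra.isUnramifiedAt_of_ramificationIdx_eq_one (maximalIdeal R) q (h.1 q)

omit [IsRegularRing A] in
variable (A) in
/-- The special fibre as a tensor product with the residue field. -/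
lemma isRegularRing_tensorProduct_residueField_iff :
    IsRegularRing (A ⊗[R] ResidueField R) ↔
      IsRegularRing (A ⧸ (maximalIdeal R).map (algebraMap R A)) :=
  let e : (A ⧸ (maximalIdeal R).map (algebraMap R A)) ≃+* A ⊗[R] ResidueField R :=
    (Algebra.TensorProduct.quotIdealMapEquivTensorQuot (A := R) A (maximalIdeal R)).toRingEquiv
  ⟨fun _ ↦ .of_ringEquiv e.symm, fun _ ↦ .of_ringEquiv e⟩

lemma isRegularRing_tensorProduct_residueField (hr : IsRamified R S)
    (hs : HasSeparableResidueExtensions R S) (h : IsRegularRing (A ⊗[R] S)) :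
    IsRegularRing (A ⊗[R] ResidueField R) := by
  let : Algebra S (A ⊗[R] S) := Algebra.TensorProduct.rightAlgebra
  have : Algebra.IsPushout R S A (A ⊗[R] S) := inferInstance
  rw [isRegularRing_tensorProduct_residueField_iff]
  obtain ⟨q, _, _, hq⟩ := hr
  have := hs q
  exact .quotient_of_ramificationIdx_ne_one (C := A ⊗[R] S) (maximalIdeal R) q
    (ne_bot_of_liesOver_maximalIdeal (R := R) q) hq.ne'

lemma isRegularRing_tensorProduct_of_residueField [Module.Flat R A]
    (h0 : Algebra.IsUnramifiedAt R (⊥ : Ideal S)) (hs : HasSeparableResidueExtensions R S)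
    (h : IsRegularRing (A ⊗[R] ResidueField R)) : IsRegularRing (A ⊗[R] S) := by
  let : Algebra S (A ⊗[R] S) := Algebra.TensorProduct.rightAlgebra
  have : Module.Flat R S := inferInstance
  have : Algebra.IsPushout R S A (A ⊗[R] S) := inferInstance
  rw [isRegularRing_tensorProduct_residueField_iff] at h
  have : IsNoetherianRing (A ⊗[R] S) := .of_finite A _
  rw [isRegularRing_iff]
  intro P _
  -- Over the generic point of `S` the extension is unramified and regularity of `A` suffices; only
  -- the other primes use the special fibre.
  by_cases hq : P.under S = ⊥
  · have : P.LiesOver (⊥ : Ideal S) := ⟨hq.symm⟩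
    exact .of_isUnramifiedAt (R := R) (A := A) (⊥ : Ideal S) P
  · have := Ideal.liesOver_maximalIdeal_of_ne_bot (R := R) hq
    have := hs (P.under S)
    exact .of_isRegularRing_quotient (A := A) (maximalIdeal R) (P.under S) hq P

end Affine

end BaseChangeRegularity

open BaseChangeRegularity TensorProduct in
theorem theoremf {R S : Type u} {K L : Type*}
    [CommRing R] [IsDomain R] [IsDiscreteValuationRing R]
    [Field K] [Algebra R K] [IsFractionRing R K]
    [Field L] [Algebra K L] [FiniteDimensional K L] [Algebra.IsSeparable K L]
    [Algebra R L] [IsScalarTower R K L]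
    [CommRing S] [Algebra R S] [Algebra S L] [IsScalarTower R S L] [IsIntegralClosure S R L]
    (X : Scheme.{u}) (f : X ⟶ Spec (CommRingCat.of R)) [LocallyOfFiniteType f]
    (hX : BaseChangeRegularity.IsRegularScheme X) :
    (BaseChangeRegularity.IsUnramified R S →
      BaseChangeRegularity.IsRegularScheme (BaseChangeRegularity.baseChange f S)) ∧
    (BaseChangeRegularity.IsRamified R S →
      BaseChangeRegularity.HasSeparableResidueExtensions R S → Flat f →
      (BaseChangeRegularity.IsRegularScheme (BaseChangeRegularity.baseChange f S) ↔
        BaseChangeRegularity.IsRegularScheme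
          (BaseChangeRegularity.baseChange f (ResidueField R)))) := by
  have : Module.Finite R S := IsIntegralClosure.finite R K L S
  have hinj : Function.Injective (algebraMap S L) := IsIntegralClosure.algebraMap_injective S R L
  have : IsDomain S := hinj.isDomain _
  have : IsDedekindDomain S := IsIntegralClosure.isDedekindDomain R K L S
  have : IsFractionRing S L := IsIntegralClosure.isFractionRing_of_finite_extension R K L S
  have : FaithfulSMul R S := by
    rw [faithfulSMul_iff_algebraMap_injective]
    refine Function.Injective.of_comp (f := algebraMap S L) ?_
    rw [← RingHom.coe_comp, ← IsScalarTower.algebraMap_eq, IsScalarTower.algebraMap_eq R K L]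
    exact (algebraMap K L).injective.comp (IsFractionRing.injective R K)
  have h0 := Algebra.isUnramifiedAt_bot_of_isSeparable R K L S
  let 𝒰 := X.affineOpenCover
  let (i : 𝒰.I₀) : Algebra R (𝒰.X i) := (Spec.preimage (𝒰.f i ≫ f)).hom.toAlgebra
  have hf (i : 𝒰.I₀) : 𝒰.f i ≫ f = Spec.map (CommRingCat.ofHom (algebraMap R (𝒰.X i))) :=
    (Spec.map_preimage (𝒰.f i ≫ f)).symm
  have hN (i : 𝒰.I₀) : IsNoetherianRing (𝒰.X i) := by
    have h : LocallyOfFiniteType (𝒰.f i ≫ f) := inferInstance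
    rw [hf, HasRingHomProperty.Spec_iff (P := @LocallyOfFiniteType)] at h
    have : Algebra.FiniteType R (𝒰.X i) := h
    exact Algebra.FiniteType.isNoetherianRing R _
  have hA (i : 𝒰.I₀) : IsRegularRing (𝒰.X i) :=
    isRegularScheme_Spec_iff.mp ((isRegularScheme_iff_openCover 𝒰.openCover).mp hX i)
  -- One chart criterion serves both `T = S` and `T = ResidueField R`, as both are finite over `R`.
  have hT (T : Type u) [CommRing T] [Algebra R T] [Module.Finite R T] :
      IsRegularScheme (baseChange f T) ↔ ∀ i, IsRegularRing (𝒰.X i ⊗[R] T) := by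
    rw [isRegularScheme_baseChange_iff_openCover 𝒰.openCover]
    refine forall_congr' fun (i : 𝒰.I₀) ↦ ?_
    rw [← isRegularScheme_baseChange_Spec_iff, ← hf]
    rfl
  rw [hT, hT]
  refine ⟨fun h i ↦ isRegularRing_tensorProduct_of_isUnramified _ h0 h, fun hr hs hflat ↦
    forall_congr' fun i ↦ ⟨isRegularRing_tensorProduct_residueField hr hs, ?_⟩⟩
  have : Module.Flat R (𝒰.X i) := by
    have h : Flat (𝒰.f i ≫ f) := inferInstance
    rwa [hf, HasRingHomProperty.Spec_iff (P := @Flat)] at h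
  exact isRegularRing_tensorProduct_of_residueField h0 hs
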